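/- Let $k$ be an algebraically closed field of characteristic $0$, $n\ge 0$ an integer, and $G\le \mathrm{SL}_{n+1}(k)$ a finite abelian group, diagonalised, so that $g\in G$ acts on $R=k[x_1,\dots,x_{n+1}]$ by $x_i\mapsto \rho_i(g)x_i$ with characters $\rho_i\in\hat G=\mathrm{Hom}(G,k^*)$. Put $m=|G|$. *Types of cuts.* Let $Q$ be the quiver of $R*G$: its vertex set is $\hat G$, and for each $\chi\in\hat G$ and each $1\le i\le n+1$ there is one arrow of type $i$ from $\chi$ to $\chi\rho_i$. An elementary cycle is a cycle of length $n+1$ whose arrows have pairwise distinct types. A cut is a set $C$ of arrows such that every elementary cycle passes through exactly one arrow of $C$; its type is $\theta(C)=(\gamma_1,\dots,\gamma_{n+1})$, where $\gamma_i$ is the number of arrows of type $i$ in $C$. Let $L_1=\{y\in\mathbb Z^n:\rho_1^{y_1}\cdots\rho_n^{y_n}=1\}$, and let $\Lambda$ be the lattice of all $\gamma\in\mathbb R^{n+1}$ with $\sum_{i=1}^{n}\gamma_iy_i\in m\mathbb Z$ for all $y\in L_1$ and $\sum_{i=1}^{n+1}\gamma_i\in m\mathbb Z$. Let $P\subset\mathbb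 R^{n+1}$ be the convex hull of the types $(0,\dots,0,m,0,\dots,0)$ of the trivial cuts (all arrows of one fixed type), considered as a polytope with lattice $\Lambda$. *Toric data.* Let $M\subseteq\mathbb Z^{n+1}$ be the character lattice of the torus $\mathbb T$ of the affine toric variety $X=\mathrm{Spec}(R^G)$, i.e. the group generated by the exponents of the $G$-invariant monomials; let $N$ be the lattice of one-parameter subgroups of $\mathbb T$, let $N_{\mathbb R}=\mathrm{Hom}(M,\mathbb R)$, and let $C\subseteq N_{\mathbb R}$ be the cone defining $X$, i.e. the set of $v$ with $\langle e,v\rangle\ge0$ for all invariant monomials $\mathbf x^e$. Let $H\subset N_{\mathbb R}$ be the hyperplane $\langle(1,\dots,1),v\rangle=1$, i.e. the degree condition $|x_1\cdots x_{n+1}|=1$. Below, a $d$-dimensional lattice simplex with respect to a lattice is the convex hull of $d+1$ affinely independent lattice points. Then: 1. $P$ is an $n$-dimensional lattice simplex with respect to $\Lambda$, and the set of types of cuts is exactly $P\cap\Lambda$. 2. $C\cap H$ is an $n$-dimensional lattice simplex with respect to $N$, and it is isomorphic to $P$: the map $\Phi:\mathbb R^{n+1}\to N_{\mathbb R}$ given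 by $\langle u,\Phi(\gamma)\rangle=\frac1m\sum_{i=1}^{n+1}u_i\gamma_i$ for $u\in M$ is a linear isomorphism with $\Phi(\Lambda)=N$ and $\Phi(P)=C\cap H$. 3. Let $\xi\in k$ be any primitive $m$-th root of unity. For $g=\mathrm{diag}(\xi^{f_1},\dots,\xi^{f_{n+1}})\in G$ with $0\le f_i<m$ put $v(g)=\frac1m(f_1,\dots,f_{n+1})$, and call $g$ junior if $\frac1m\sum_i f_i=1$. Let $N_G\subset\mathbb R^{n+1}$ be the lattice generated by $\mathbb Z^{n+1}$ and all $v(g)$, $g\in G$, and let $\Delta=\{w\in\mathbb R^{n+1}: w_i\ge0,\ \sum_i w_i=1\}$ be the junior simplex. Then $\Delta$ is an $n$-dimensional lattice simplex with respect to $N_G$, and $\gamma\mapsto\gamma/m$ is a linear isomorphism taking $\Lambda$ onto $N_G$ and $P$ onto $\Delta$. Moreover $g\mapsto v(g)$ is a bijection from the set of junior elements of $G$ onto the set of lattice points $\Delta\cap N_G$ that are not vertices of $\Delta$. -/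

import Mathlib

open scoped BigOperators

noncomputable section

namespace CutTypes

/-! ### Lattice simplices -/

section Lattices

variable {V : Type*} [AddCommGroup V] [Module ℝ V]

/-- A (full) lattice in a real vector space: the integral span of a finite real basis. -/
def IsLattice (Λ : AddSubgroup V) : Prop :=
  ∃ (r : ℕ) (b : Module.Basis (Fin r) ℝ V), Λ = (Submodule.span ℤ (Set.range b)).toAddSubgroup

/-- `P` is a `d`-dimensional lattice simplex with respect to the lattice `Λ`: the convex hull
of `d + 1` affinely independent points of `Λ`. -/
def IsLatticeSimplex (d : ℕ) (Λ : AddSubgroup V) (P : Set V) : Prop :=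
  IsLattice Λ ∧ ∃ v : Fin (d + 1) → V,
    AffineIndependent ℝ v ∧ (∀ i, v i ∈ Λ) ∧ P = convexHull ℝ (Set.range v)

/-- The linear isomorphism `Φ` of the ambient spaces is an isomorphism of the lattice polytope
`P` (with lattice `Λ`) with the lattice polytope `P'` (with lattice `Λ'`). -/
def IsLatticePolytopeIso {W : Type*} [AddCommGroup W] [Module ℝ W] (Φ : V ≃ₗ[ℝ] W)
    (Λ : AddSubgroup V) (P : Set V) (Λ' : AddSubgroup W) (P' : Set W) : Prop :=
  Φ '' (Λ : Set V) = (Λ' : Set W) ∧ Φ '' P = P'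

end Lattices

/-! ### The group, its weights and the McKay quiver -/

variable {k : Type*} [Field k] {n : ℕ}

/-- The action of `G` on `V = ⟨x_1, …, x_{n+1}⟩` is diagonalised. -/
def IsDiagonalGroup (G : Subgroup (Matrix.SpecialLinearGroup (Fin (n + 1)) k)) : Prop :=
  ∀ g ∈ G, (g : Matrix (Fin (n + 1)) (Fin (n + 1)) k).IsDiag

variable {G : Subgroup (Matrix.SpecialLinearGroup (Fin (n + 1)) k)}

theorem IsDiagonalGroup.mul_apply_self (hG : IsDiagonalGroup G) (g h : G) (i : Fin (n + 1)) :
    ((g * h : G) : Matrix.SpecialLinearGroup (Fin (n + 1)) k).1 i i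
      = g.1.1 i i * h.1.1 i i := by
  have h1 : ((g * h : G) : Matrix.SpecialLinearGroup (Fin (n + 1)) k).1 = g.1.1 * h.1.1 := rfl
  rw [h1, Matrix.mul_apply, Finset.sum_eq_single i]
  · intro j _ hj
    rw [hG g.1 g.2 (Ne.symm hj), zero_mul]
  · simp

/-- The character `ρ_i` of `G` by which `G` acts on `x_i`. -/
def weight (hG : IsDiagonalGroup G) (i : Fin (n + 1)) : G →* kˣ :=
  MonoidHom.toHomUnits
    { toFun := fun g => g.1.1 i i
      map_one' := by
        change (1 : Matrix (Fin (n + 1)) (Fin (n + 1)) k) i i = 1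
        simp
      map_mul' := fun g h => hG.mul_apply_self g h i }

/-- An arrow of the quiver `Q` of `R ∗ G`: the arrow of type `ty` starting at the vertex `src`.
The vertices are the irreducible characters of `G`. -/
structure Arrow (G : Subgroup (Matrix.SpecialLinearGroup (Fin (n + 1)) k)) where
  src : G →* kˣ
  ty : Fin (n + 1)

/-- The target of the arrow of type `i` starting at `χ` is `χ ρ_i`. -/
def Arrow.tgt (hG : IsDiagonalGroup G) (a : Arrow G) : G →* kˣ :=
  a.src * weight hG a.ty

/-- An elementary cycle: a cycle of length `n + 1` in `Q` whose arrows have `n + 1` distinct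
types (the index `j + 1` is taken cyclically). -/
def IsElementaryCycle (hG : IsDiagonalGroup G) (c : Fin (n + 1) → Arrow G) : Prop :=
  (∀ j, (c j).tgt hG = (c (j + 1)).src) ∧ Function.Injective fun j => (c j).ty

/-- A cut: a set of arrows of `Q` such that every elementary cycle passes through exactly one
of them. -/
def IsCut (hG : IsDiagonalGroup G) (C : Set (Arrow G)) : Prop :=
  ∀ c : Fin (n + 1) → Arrow G, IsElementaryCycle hG c → ∃! j, c j ∈ C

/-- The type `θ(C)` of a set of arrows: the numbers of its arrows of each type. -/
def typeVector (C : Set (Arrow G)) : Fin (n + 1) → ℝ :=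
  fun i => ({a | a ∈ C ∧ a.ty = i}.ncard : ℝ)

/-- The trivial cut consisting of all arrows of type `i`. -/
def trivialCut (G : Subgroup (Matrix.SpecialLinearGroup (Fin (n + 1)) k)) (i : Fin (n + 1)) :
    Set (Arrow G) :=
  {a | a.ty = i}

/-- The set of all types of cuts. -/
def cutTypes (hG : IsDiagonalGroup G) : Set (Fin (n + 1) → ℝ) :=
  {γ | ∃ C : Set (Arrow G), IsCut hG C ∧ γ = typeVector C}

/-! ### The lattice simplex of types of cuts -/

/-- `L_1 ⊆ L_0 = ℤⁿ`: the kernel of the homomorphism from `L_0` to the dual group of `G` that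
sends the `i`-th basis vector `α_i` to `ρ_i`, for `i = 1, …, n` (an element of the dual group
is trivial if it is so at every `g`). -/
def kernelLattice (hG : IsDiagonalGroup G) : AddSubgroup (Fin n → ℤ) where
  carrier := {y | ∀ g : G, ∏ i : Fin n, weight hG i.castSucc g ^ y i = 1}
  zero_mem' := fun g => by simp
  add_mem' := by
    intro a b ha hb g
    have h1 := ha g
    have h2 := hb g
    simp [zpow_add, Finset.prod_mul_distrib, h1, h2]
  neg_mem' := by
    intro a ha g
    have h1 := ha g
    simp [zpow_neg, Finset.prod_inv_distrib, h1]

/-- The lattice `m ℤ^{1 × (n+1)} B⁻¹` of all row vectors `γ` with `γ B ∈ m ℤ^{1 × (n+1)}`, where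
`m = |G|` and the columns of `B` are a basis of `L_1` (with last entry `0`) followed by the
all-ones vector. -/
def typeLattice (hG : IsDiagonalGroup G) : AddSubgroup (Fin (n + 1) → ℝ) where
  carrier := {γ |
    (∀ y ∈ kernelLattice hG, ∃ z : ℤ,
      ∑ i : Fin n, γ i.castSucc * (y i : ℝ) = (Nat.card G : ℝ) * z) ∧
    ∃ z : ℤ, ∑ i, γ i = (Nat.card G : ℝ) * z}
  zero_mem' := ⟨fun _ _ => ⟨0, by simp⟩, 0, by simp⟩
  add_mem' := by
    rintro a b ⟨ha, za, ha'⟩ ⟨hb, zb, hb'⟩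
    refine ⟨fun y hy => ?_, za + zb, ?_⟩
    · obtain ⟨z, hz⟩ := ha y hy
      obtain ⟨w, hw⟩ := hb y hy
      refine ⟨z + w, ?_⟩
      simp only [Pi.add_apply, add_mul, Finset.sum_add_distrib, hz, hw]
      push_cast
      ring
    · simp only [Pi.add_apply, Finset.sum_add_distrib, ha', hb']
      push_cast
      ring
  neg_mem' := by
    rintro a ⟨ha, za, ha'⟩
    refine ⟨fun y hy => ?_, -za, ?_⟩
    · obtain ⟨z, hz⟩ := ha y hy
      refine ⟨-z, ?_⟩
      simp only [Pi.neg_apply, neg_mul, Finset.sum_neg_distrib, hz]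
      push_cast
      ring
    · simp only [Pi.neg_apply, Finset.sum_neg_distrib, ha']
      push_cast
      ring

/-- The simplex `P`: the convex hull of the types of the trivial cuts. -/
def typeSimplex (G : Subgroup (Matrix.SpecialLinearGroup (Fin (n + 1)) k)) :
    Set (Fin (n + 1) → ℝ) :=
  convexHull ℝ (Set.range fun i => typeVector (trivialCut G i))

/-! ### The toric variety `Spec R^G` -/

/-- The action of a matrix on `R = k[x_1, …, x_{n+1}]` which on the linear forms is left
multiplication, that is, `x_j ↦ ∑_i g_{ij} x_i`. -/
def polyAct (g : Matrix.SpecialLinearGroup (Fin (n + 1)) k) :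
    MvPolynomial (Fin (n + 1)) k →ₐ[k] MvPolynomial (Fin (n + 1)) k :=
  MvPolynomial.aeval fun j => ∑ i, MvPolynomial.C (g.1 i j) * MvPolynomial.X i

/-- The invariant ring `R^G`. -/
def invariantRing (G : Subgroup (Matrix.SpecialLinearGroup (Fin (n + 1)) k)) :
    Subalgebra k (MvPolynomial (Fin (n + 1)) k) where
  carrier := {f | ∀ g ∈ G, polyAct g f = f}
  mul_mem' := by
    intro a b ha hb g hg
    rw [map_mul, ha g hg, hb g hg]
  add_mem' := by
    intro a b ha hb g hg
    rw [map_add, ha g hg, hb g hg]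
  algebraMap_mem' := fun r g _ => (polyAct g).commutes r

/-- The exponents (as integral vectors) of the invariant monomials. -/
def invariantExponents (G : Subgroup (Matrix.SpecialLinearGroup (Fin (n + 1)) k)) :
    Set (Fin (n + 1) → ℤ) :=
  {u | ∃ e : Fin (n + 1) →₀ ℕ, MvPolynomial.monomial e (1 : k) ∈ invariantRing G ∧
    ∀ i, u i = (e i : ℤ)}

/-- The character lattice `M` of the torus of `Spec R^G`: the group generated by the exponents
of the invariant monomials. -/
def charLattice (G : Subgroup (Matrix.SpecialLinearGroup (Fin (n + 1)) k)) :
    AddSubgroup (Fin (n + 1) → ℤ) :=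
  AddSubgroup.closure (invariantExponents G)

/-- The (`k`-points of the) torus `𝕋 = Hom(M, kˣ)` of `Spec R^G`. -/
abbrev torus (G : Subgroup (Matrix.SpecialLinearGroup (Fin (n + 1)) k)) : Type _ :=
  Multiplicative (charLattice G) →* kˣ

/-- The group `N` of one-parameter subgroups of the torus: the group homomorphisms `kˣ → 𝕋` that
are morphisms of varieties, i.e. whose composites with all characters of `𝕋` are given by
Laurent polynomials. -/
def oneParam (G : Subgroup (Matrix.SpecialLinearGroup (Fin (n + 1)) k)) :
    Subgroup (kˣ →* torus G) where
  carrier := {l | ∀ u : charLattice G, ∃ p : LaurentPolynomial k, ∀ t : kˣ,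
    ((l t (Multiplicative.ofAdd u) : kˣ) : k) = p.eval₂ (RingHom.id k) t}
  one_mem' := fun u => ⟨1, fun t => by simp⟩
  mul_mem' := by
    intro a b ha hb u
    obtain ⟨p, hp⟩ := ha u
    obtain ⟨q, hq⟩ := hb u
    refine ⟨p * q, fun t => ?_⟩
    rw [map_mul, ← hp, ← hq]
    simp
  inv_mem' := by
    intro a ha u
    obtain ⟨p, hp⟩ := ha (-u)
    refine ⟨p, fun t => ?_⟩
    rw [← hp]
    simp

/-- An endomorphism of `kˣ` given by a Laurent polynomial is `t ↦ t ^ a` for an integer `a`. -/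
theorem exists_zpow_of_laurent (f : kˣ →* kˣ) (p : LaurentPolynomial k)
    (hp : ∀ t : kˣ, (f t : k) = p.eval₂ (RingHom.id k) t) : ∃ a : ℤ, ∀ t, f t = t ^ a := by
  classical
  let χ : ℤ → (kˣ →* k) := fun a => (Units.coeHom k).comp (zpowGroupHom a)
  by_contra hcon
  have hmem : (Units.coeHom k).comp f ∉ Set.range χ := by
    rintro ⟨a, ha⟩
    refine hcon ⟨a, fun t => Units.ext ?_⟩
    exact (DFunLike.congr_fun ha t).symm
  have hns := (linearIndependent_monoidHom kˣ k).notMem_span_image hmem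
  apply hns
  have key : ∀ q : LaurentPolynomial k, (fun t : kˣ => q.eval₂ (RingHom.id k) t) ∈
      Submodule.span k ((fun f : kˣ →* k => (f : kˣ → k)) '' Set.range χ) := by
    intro q
    induction q using LaurentPolynomial.induction_on' with
    | add p q hp hq =>
      simp only [map_add]
      exact Submodule.add_mem _ hp hq
    | C_mul_T a r =>
      simp only [LaurentPolynomial.eval₂_C_mul_T]
      refine Submodule.smul_mem _ r (Submodule.subset_span ⟨χ a, ⟨a, rfl⟩, rfl⟩)
  have h2 := key p
  convert h2 using 1
  funext t
  exact hp t

theorem exists_pairing (u : charLattice G) (l : oneParam G) :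
    ∃ a : ℤ, ∀ t : kˣ, l.1 t (Multiplicative.ofAdd u) = t ^ a := by
  obtain ⟨p, hp⟩ := l.2 u
  exact exists_zpow_of_laurent
    ((MonoidHom.eval (Multiplicative.ofAdd u)).comp l.1) p hp

/-- The pairing `⟨u, l⟩` of `M` with `N`: the integer `a` such that the composite of the
one-parameter subgroup `l` with the character `u` is `t ↦ t ^ a`. In other words, `l` makes
`R^G` a graded ring in which `𝐱^u` has degree `⟨u, l⟩`. -/
def pairing (u : charLattice G) (l : oneParam G) : ℤ :=
  (exists_pairing u l).choose

theorem pairing_spec (u : charLattice G) (l : oneParam G) (t : kˣ) :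
    l.1 t (Multiplicative.ofAdd u) = t ^ pairing u l :=
  (exists_pairing u l).choose_spec t

theorem eq_of_forall_zpow_eq [CharZero k] {a b : ℤ} (h : ∀ t : kˣ, t ^ a = t ^ b) : a = b := by
  have h2 : (2 : k) ≠ 0 := two_ne_zero
  have h3 := congrArg (fun x : kˣ => (x : k)) (h (Units.mk0 2 h2))
  simp only [Units.val_zpow_eq_zpow_val, Units.val_mk0] at h3
  have h4 : ((2 : ℚ) ^ a : ℚ) = (2 : ℚ) ^ b := by
    apply (algebraMap ℚ k).injective
    simpa using h3
  exact zpow_right_injective₀ (by norm_num) (by norm_num) h4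

theorem pairing_add_left [CharZero k] (u v : charLattice G) (l : oneParam G) :
    pairing (u + v) l = pairing u l + pairing v l := by
  apply eq_of_forall_zpow_eq (k := k)
  intro t
  rw [← pairing_spec, zpow_add, ← pairing_spec, ← pairing_spec, ofAdd_add, map_mul]

theorem pairing_mul_right [CharZero k] (u : charLattice G) (l l' : oneParam G) :
    pairing u (l * l') = pairing u l + pairing u l' := by
  apply eq_of_forall_zpow_eq (k := k)
  intro t
  rw [← pairing_spec, zpow_add, ← pairing_spec, ← pairing_spec]
  rfl

/-- The embedding of `N` (written additively) into `N_ℝ = Hom(M, ℝ)`. -/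
def oneParamToReal [CharZero k] (G : Subgroup (Matrix.SpecialLinearGroup (Fin (n + 1)) k)) :
    Additive (oneParam G) →+ (charLattice G →+ ℝ) :=
  AddMonoidHom.mk'
    (fun l => AddMonoidHom.mk' (fun u => (pairing u l.toMul : ℝ)) fun u v => by
      rw [pairing_add_left]; push_cast; rfl)
    fun l l' => by
      ext u
      simp [pairing_mul_right]

theorem oneParamToReal_injective [CharZero k] :
    Function.Injective (oneParamToReal G) := by
  intro l l' h
  apply Additive.toMul.injective
  apply Subtype.ext
  refine MonoidHom.ext fun t => MonoidHom.ext fun u => ?_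
  have h1 : (pairing u.toAdd l.toMul : ℝ) = pairing u.toAdd l'.toMul :=
    DFunLike.congr_fun h u.toAdd
  have h2 : pairing u.toAdd l.toMul = pairing u.toAdd l'.toMul := by exact_mod_cast h1
  have h3 := pairing_spec u.toAdd l.toMul t
  rw [h2, ← pairing_spec] at h3
  exact h3

/-- The lattice `N` inside `N_ℝ`. -/
def oneParamLattice [CharZero k] (G : Subgroup (Matrix.SpecialLinearGroup (Fin (n + 1)) k)) :
    AddSubgroup (charLattice G →+ ℝ) :=
  (oneParamToReal G).range

/-- The cone `C ⊆ N_ℝ` defining `Spec R^G`: the dual of the cone in `M_ℝ` generated by the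
exponents of the invariant monomials. -/
def definingCone (G : Subgroup (Matrix.SpecialLinearGroup (Fin (n + 1)) k)) :
    Set (charLattice G →+ ℝ) :=
  {v | ∀ u : charLattice G, (u : Fin (n + 1) → ℤ) ∈ invariantExponents G → 0 ≤ v u}

theorem polyAct_monomial (hG : IsDiagonalGroup G) {g : Matrix.SpecialLinearGroup (Fin (n + 1)) k}
    (hg : g ∈ G) (e : Fin (n + 1) →₀ ℕ) (r : k) :
    polyAct g (MvPolynomial.monomial e r)
      = MvPolynomial.monomial e ((∏ i, g.1 i i ^ e i) * r) := by
  have hX : ∀ j, (∑ i, MvPolynomial.C (g.1 i j) * MvPolynomial.X i :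
      MvPolynomial (Fin (n + 1)) k) = MvPolynomial.C (g.1 j j) * MvPolynomial.X j := by
    intro j
    rw [Finset.sum_eq_single j]
    · intro i _ hi
      rw [hG g hg hi, map_zero, zero_mul]
    · simp
  rw [polyAct, MvPolynomial.aeval_monomial, MvPolynomial.monomial_eq]
  simp only [hX]
  rw [Finsupp.prod_fintype _ _ (by simp), Finsupp.prod_fintype _ _ (by simp)]
  simp only [mul_pow, Finset.prod_mul_distrib, map_mul, map_prod, map_pow,
    MvPolynomial.algebraMap_eq]
  ring

theorem ones_mem_charLattice (hG : IsDiagonalGroup G) :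
    (fun _ => 1 : Fin (n + 1) → ℤ) ∈ charLattice G := by
  refine AddSubgroup.subset_closure ⟨Finsupp.equivFunOnFinite.symm fun _ => 1, ?_, by simp⟩
  intro g hg
  rw [polyAct_monomial hG hg]
  have h1 : ∏ i, g.1 i i = 1 := by
    have hdet := g.2
    have hdg : Matrix.diagonal (fun i => g.1 i i) = g.1 := (hG g hg).diagonal_diag
    rw [← hdg, Matrix.det_diagonal] at hdet
    exact hdet
  simp [h1]

theorem prod_zpow_eq_one (hG : IsDiagonalGroup G) (g : G) {u : Fin (n + 1) → ℤ}
    (hu : u ∈ charLattice G) : ∏ i, weight hG i g ^ u i = 1 := by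
  induction hu using AddSubgroup.closure_induction with
  | mem u hu =>
    obtain ⟨e, he, hue⟩ := hu
    have h := he g.1 g.2
    rw [polyAct_monomial hG g.2, mul_one] at h
    have h2 := congrArg (MvPolynomial.coeff e) h
    rw [MvPolynomial.coeff_monomial, MvPolynomial.coeff_monomial, if_pos rfl, if_pos rfl] at h2
    apply Units.ext
    simp only [Units.coe_prod, Units.val_zpow_eq_zpow_val, Units.val_one]
    rw [← h2]
    refine Finset.prod_congr rfl fun i _ => ?_
    rw [hue i, zpow_natCast]
    rfl
  | zero => simp
  | add a b _ _ ha hb => simp [zpow_add, Finset.prod_mul_distrib, ha, hb]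
  | neg a _ ha => simp [zpow_neg, Finset.prod_inv_distrib, ha]

/-- The cone `C` defines `Spec R^G`: the exponents of the invariant monomials are the points of
`M` in the dual cone of `C`. -/
theorem mem_invariantExponents_iff (hG : IsDiagonalGroup G) (u : charLattice G) :
    (u : Fin (n + 1) → ℤ) ∈ invariantExponents G ↔ ∀ v ∈ definingCone G, 0 ≤ v u := by
  refine ⟨fun h v hv => hv u h, fun h => ?_⟩
  have hnn : ∀ i, 0 ≤ u.1 i := by
    intro i
    have := h (AddMonoidHom.mk' (fun w : charLattice G => ((w.1 i : ℤ) : ℝ))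
      fun a b => by simp) ?_
    · simpa using this
    · rintro w ⟨e, -, he⟩
      simp [he]
  refine ⟨Finsupp.equivFunOnFinite.symm fun i => (u.1 i).toNat, ?_, fun i => by simp [hnn i]⟩
  intro g hg
  rw [polyAct_monomial hG hg, mul_one]
  congr 1
  have h1 := congrArg (fun x : kˣ => (x : k)) (prod_zpow_eq_one hG ⟨g, hg⟩ u.2)
  simp only [Units.coe_prod, Units.val_zpow_eq_zpow_val, Units.val_one] at h1
  refine Eq.trans ?_ h1
  refine Finset.prod_congr rfl fun i _ => ?_
  change _ = g.1 i i ^ u.1 i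
  conv_rhs => rw [← Int.toNat_of_nonneg (hnn i), zpow_natCast]
  rfl

/-- `R^G` is spanned by the invariant monomials. -/
theorem monomial_mem_of_mem_support (hG : IsDiagonalGroup G) {f : MvPolynomial (Fin (n + 1)) k}
    (hf : f ∈ invariantRing G) {e : Fin (n + 1) →₀ ℕ} (he : e ∈ f.support) :
    MvPolynomial.monomial e (1 : k) ∈ invariantRing G := by
  intro g hg
  have hc : ∀ p : MvPolynomial (Fin (n + 1)) k,
      (polyAct g p).coeff e = (∏ i, g.1 i i ^ e i) * p.coeff e := by
    intro p
    induction p using MvPolynomial.induction_on' with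
    | monomial d r =>
      classical
      rw [polyAct_monomial hG hg, MvPolynomial.coeff_monomial, MvPolynomial.coeff_monomial]
      split_ifs with h
      · rw [h]
      · simp
    | add p q hp hq => simp [hp, hq, mul_add]
  have h1 := hc f
  rw [hf g hg] at h1
  have h2 : f.coeff e ≠ 0 := MvPolynomial.mem_support_iff.mp he
  have h3 : (∏ i, g.1 i i ^ e i) = 1 := by
    apply mul_right_cancel₀ h2
    rw [← h1, one_mul]
  rw [polyAct_monomial hG hg, h3, mul_one]

/-- The hyperplane in `N_ℝ` given by the degree condition `|x_1 ⋯ x_{n+1}| = 1`. -/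
def degreeOneHyperplane (hG : IsDiagonalGroup G) : Set (charLattice G →+ ℝ) :=
  {v | v ⟨fun _ => 1, ones_mem_charLattice hG⟩ = 1}

/-- The slice of the defining cone by the hyperplane `|x_1 ⋯ x_{n+1}| = 1`. -/
def coneSlice (hG : IsDiagonalGroup G) : Set (charLattice G →+ ℝ) :=
  definingCone G ∩ degreeOneHyperplane hG

/-! ### Junior elements -/

/-- For `g = diag(ξ^{f_1}, …, ξ^{f_{n+1}})` with `0 ≤ f_i < m = |G|` and `ξ` a primitive `m`-th
root of unity, the vector `(f_1, …, f_{n+1}) / m`. It does not change if `m` and `ξ` are replaced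
by the order `r` of `g` and `ξ^{m/r}`. -/
def ageVector (ξ : k) (g : G) : Fin (n + 1) → ℝ :=
  fun i => ((sInf {f : ℕ | ξ ^ f = g.1.1 i i} : ℕ) : ℝ) / (Nat.card G : ℝ)

/-- The lattice `N_G` generated by `ℤ^{n+1}` and the vectors `(f_1, …, f_{n+1}) / m` of the
elements of `G`. -/
def groupLattice (G : Subgroup (Matrix.SpecialLinearGroup (Fin (n + 1)) k)) (ξ : k) :
    AddSubgroup (Fin (n + 1) → ℝ) :=
  AddSubgroup.closure
    ({v | ∃ z : Fin (n + 1) → ℤ, ∀ i, v i = z i} ∪ Set.range fun g : G => ageVector ξ g)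

/-- An element `g = (f_1, …, f_{n+1}) / m` is junior if `f_1 + ⋯ + f_{n+1} = m`. -/
def IsJunior (ξ : k) (g : G) : Prop :=
  ∑ i, ageVector ξ g i = 1

end CutTypes

end

/-!
The three simplices are one and the same simplex in three coordinate systems, and the lattices are
three descriptions of the dual of `M`.

*Lattices.* The group `M` is the kernel of the homomorphism `ℤ^{n+1} → Ĝ`, `u ↦ ∏ ρ_i^{u_i}`
(`mem_charLattice_iff`). As `∏ ρ_i = 1`, it is the direct sum of `L_1` and the multiples of the
all-ones vector, so `Λ` consists of the `γ` with `⟨u, γ⟩ ∈ m ℤ` for all `u ∈ M`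
(`mem_typeLattice_iff`), and it lies between `m ℤ^{n+1}` and `ℤ^{n+1}`. On the other hand
`N = Hom(M, ℤ)` (`mem_oneParamLattice_iff`), so `Φ` takes `Λ` onto `N`. Finally `Λ / m = N_G`
(`dilation_image_typeLattice`): if `a ∈ Λ` and `ξ` is a primitive `m`-th root of unity, then the
diagonal matrix with entries `ξ^{a_i}` is killed by all characters in `M`, hence belongs to `G` by
the duality of finite abelian groups (`exists_weight_eq_zpow`). The simplices correspond because
`m e_i` is an invariant exponent for every `i`.

*Types of cuts lie in `P ∩ Λ`* (`IsCut.typeVector_mem`). The indicator function of a cut gives weight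
`1` to every elementary cycle. Comparing the cycles that begin with types `i, j` and `j, i` shows
that the weight of a path depends only on its starting point and on the number of arrows of each
type. A closed path then has the same weight from every starting point, and summing over all
starting points gives the congruences that define `Λ`.

*Lattice points of `P` are types of cuts* (`mem_cutTypes_of_mem`). A point `γ ∈ P ∩ Λ` comes from an
element `g ∈ G` with `ρ_i(g) = ξ^{γ_i}`. Writing `χ(g) = ξ^{h(χ)}` with `0 ≤ h(χ) < m`, the arrows
along which `h` wraps around modulo `m` form a cut of type `γ`.
-/

noncomputable section

namespace CutTypes

/-! ### Lattice simplices and linear isomorphisms -/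

section LatticeTransport

variable {V W : Type*} [AddCommGroup V] [Module ℝ V] [AddCommGroup W] [Module ℝ W]

theorem IsLattice.of_image_eq {Λ : AddSubgroup V} {Λ' : AddSubgroup W} (hΛ : IsLattice Λ)
    (Φ : V ≃ₗ[ℝ] W) (h : Φ '' (Λ : Set V) = (Λ' : Set W)) : IsLattice Λ' := by
  obtain ⟨r, b, rfl⟩ := hΛ
  refine ⟨r, b.map Φ, SetLike.coe_injective ?_⟩
  have h1 : Set.range (b.map Φ) = (Φ.toLinearMap.restrictScalars ℤ) '' Set.range b := by
    rw [← Set.range_comp]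
    rfl
  rw [← h, h1, Submodule.span_image]
  rfl

theorem IsLatticeSimplex.of_iso {d : ℕ} {Λ : AddSubgroup V} {P : Set V} {Λ' : AddSubgroup W}
    {P' : Set W} (hP : IsLatticeSimplex d Λ P) (Φ : V ≃ₗ[ℝ] W)
    (h : IsLatticePolytopeIso Φ Λ P Λ' P') : IsLatticeSimplex d Λ' P' := by
  obtain ⟨hΛ, v, hv, hmem, rfl⟩ := hP
  refine ⟨hΛ.of_image_eq Φ h.1, Φ ∘ v, ?_, fun i => ?_, ?_⟩
  · exact hv.map' Φ.toLinearMap.toAffineMap Φ.injective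
  · rw [← SetLike.mem_coe, ← h.1]
    exact Set.mem_image_of_mem _ (hmem i)
  · rw [← h.2, Set.range_comp]
    exact Φ.toLinearMap.image_convexHull _

/-- A group of integral vectors which contains `m ℤ^ι` for some `m ≠ 0` is a lattice. -/
theorem isLattice_of_smul_single_mem {ι : Type*} [Fintype ι] [DecidableEq ι]
    {Λ : AddSubgroup (ι → ℝ)} {m : ℝ} (hm : m ≠ 0) (hsingle : ∀ i, Pi.single i m ∈ Λ)
    (hint : ∀ γ ∈ Λ, ∀ i, ∃ z : ℤ, γ i = z) : IsLattice Λ := by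
  let L : Submodule ℤ (ι → ℝ) := AddSubgroup.toIntSubmodule Λ
  let L₀ : Submodule ℤ (ι → ℝ) := Submodule.span ℤ (Set.range (Pi.basisFun ℝ ι))
  have hle : (L : Set (ι → ℝ)) ⊆ L₀ := by
    intro γ hγ
    refine ((Pi.basisFun ℝ ι).mem_span_iff_repr_mem ℤ γ).2 fun i => ?_
    obtain ⟨z, hz⟩ := hint γ hγ i
    exact ⟨z, by simp [hz]⟩
  have hdisc₀ : DiscreteTopology L₀ := inferInstance
  have hdisc : DiscreteTopology L := DiscreteTopology.of_subset hdisc₀ hle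
  have hspan : IsZLattice ℝ L := by
    refine ⟨eq_top_iff.2 ?_⟩
    rw [← (Pi.basisFun ℝ ι).span_eq, Submodule.span_le]
    rintro _ ⟨i, rfl⟩
    have h1 : Pi.basisFun ℝ ι i = m⁻¹ • (Pi.single i m : ι → ℝ) := by
      rw [← Pi.single_smul]
      simp [hm]
    rw [h1]
    exact Submodule.smul_mem _ _ (Submodule.subset_span (hsingle i))
  have hfree : Module.Free ℤ L := ZLattice.module_free ℝ L
  have hfin : Module.Finite ℤ L := ZLattice.module_finite ℝ L
  let b := (Module.finBasis ℤ L).ofZLatticeBasis ℝ L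
  refine ⟨_, b, ?_⟩
  rw [Module.Basis.ofZLatticeBasis_span]
  ext
  rfl

end LatticeTransport

/-! ### Duality for a faithful family of characters -/

section Duality

variable {A ι k : Type*} [CommGroup A] [Finite A] [CommMonoid k]
  [HasEnoughRootsOfUnity k (Monoid.exponent A)] {ρ : ι → A →* kˣ}

/-- Characters of a finite abelian group with trivial common kernel generate the dual group: by
double duality, a character of the dual group that kills them all is the evaluation at an element
of their common kernel. -/
theorem closure_range_eq_top_of_faithful (hρ : ∀ g, (∀ i, ρ i g = 1) → g = 1) :
    Subgroup.closure (Set.range ρ) = ⊤ := by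
  have : HasEnoughRootsOfUnity k (Monoid.exponent (A →* kˣ)) := by
    rwa [Monoid.exponent_eq_of_mulEquiv
      (CommGroup.monoidHom_mulEquiv_of_hasEnoughRootsOfUnity A k).some]
  have : Finite (A →* kˣ) :=
    Finite.of_equiv A (CommGroup.monoidHom_mulEquiv_of_hasEnoughRootsOfUnity A k).some.symm
  refine eq_top_iff.2 fun χ _ => ?_
  rw [← CommGroup.forall_monoidHom_apply_eq_one_iff k]
  intro η hη
  rw [← CommGroup.apply_monoidHomMonoidHomEquiv]
  have h1 : CommGroup.monoidHomMonoidHomEquiv A k η = 1 := hρ _ fun i => by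
    rw [CommGroup.apply_monoidHomMonoidHomEquiv]
    exact hη _ (Subgroup.subset_closure ⟨i, rfl⟩)
  rw [h1, map_one]

/-- The homomorphism `ℤ^ι → B` (written multiplicatively) sending the `i`-th basis vector to
`s i`. -/
def monomialHom {B ι : Type*} [CommGroup B] [Fintype ι] (s : ι → B) :
    Multiplicative (ι → ℤ) →* B where
  toFun u := ∏ i, s i ^ u.toAdd i
  map_one' := by simp
  map_mul' u v := by simp [zpow_add, Finset.prod_mul_distrib]

theorem monomialHom_single {B ι : Type*} [CommGroup B] [Fintype ι] [DecidableEq ι] (s : ι → B)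
    (i : ι) : monomialHom s (.ofAdd (Pi.single i 1)) = s i := by
  change ∏ j, s j ^ (Pi.single i 1 : ι → ℤ) j = s i
  rw [Finset.prod_eq_single i] <;> simp +contextual

/-- A point of a torus which satisfies all monomial equations satisfied by a finite diagonal group
belongs to that group. -/
theorem exists_apply_eq_of_forall_prod_zpow [Fintype ι]
    (hρ : ∀ g, (∀ i, ρ i g = 1) → g = 1) (t : ι → kˣ)
    (ht : ∀ u : ι → ℤ, ∏ i, ρ i ^ u i = 1 → ∏ i, t i ^ u i = 1) :
    ∃ g, ∀ i, ρ i g = t i := by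
  classical
  have hsurj : Function.Surjective (monomialHom ρ) := by
    rw [← MonoidHom.range_eq_top, eq_top_iff, ← closure_range_eq_top_of_faithful hρ,
      Subgroup.closure_le]
    rintro _ ⟨i, rfl⟩
    exact ⟨_, monomialHom_single ρ i⟩
  -- `ρ i ↦ t i` extends to a character of the dual group, which is an evaluation
  let η : (A →* kˣ) →* kˣ := (monomialHom ρ).liftOfRightInverse
    (Function.surjInv hsurj) (Function.rightInverse_surjInv hsurj)
    ⟨monomialHom t, fun u hu => ht u.toAdd hu⟩
  refine ⟨CommGroup.monoidHomMonoidHomEquiv A k η, fun i => ?_⟩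
  rw [CommGroup.apply_monoidHomMonoidHomEquiv, ← monomialHom_single ρ i,
    ← monomialHom_single t i]
  exact MonoidHom.liftOfRightInverse_comp_apply ..

end Duality

variable {k : Type*} [Field k] {n : ℕ}
variable {G : Subgroup (Matrix.SpecialLinearGroup (Fin (n + 1)) k)}

/-! ### The weights of a diagonal group -/

theorem IsDiagonalGroup.ext (hG : IsDiagonalGroup G) {g h : G}
    (H : ∀ i, g.1.1 i i = h.1.1 i i) : g = h := by
  refine Subtype.ext (Subtype.ext (Matrix.ext fun i j => ?_))
  by_cases hij : i = j
  · exact hij ▸ H i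
  · rw [hG g.1 g.2 hij, hG h.1 h.2 hij]

/-- A diagonal group is commutative. -/
abbrev IsDiagonalGroup.commGroup (hG : IsDiagonalGroup G) : CommGroup G :=
  { (inferInstance : Group G) with
    mul_comm := fun g h => hG.ext fun i => by
      rw [hG.mul_apply_self, hG.mul_apply_self, mul_comm] }

theorem coe_weight (hG : IsDiagonalGroup G) (i : Fin (n + 1)) (g : G) :
    (weight hG i g : k) = g.1.1 i i := rfl

theorem prod_weight (hG : IsDiagonalGroup G) : ∏ i, weight hG i = 1 := by
  ext g
  have h := prod_zpow_eq_one hG g (ones_mem_charLattice hG)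
  simpa using congrArg Units.val h

theorem eq_one_of_weight_eq_one (hG : IsDiagonalGroup G) (g : G) (h : ∀ i, weight hG i g = 1) :
    g = 1 := by
  refine hG.ext fun i => ?_
  rw [← coe_weight hG, h i]
  change 1 = (1 : Matrix (Fin (n + 1)) (Fin (n + 1)) k) i i
  simp

theorem apply_pow_card [Finite G] (χ : G →* kˣ) (g : G) : χ g ^ Nat.card G = 1 := by
  rw [← map_pow, pow_card_eq_one', map_one]

section Dual

variable [IsAlgClosed k] [CharZero k] [Finite G]

theorem hasEnoughRootsOfUnity_exponent :
    HasEnoughRootsOfUnity k (Monoid.exponent G) := by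
  have : NeZero ((Monoid.exponent G : ℕ) : k) :=
    ⟨Nat.cast_ne_zero.2 Monoid.exponent_ne_zero_of_finite⟩
  infer_instance

theorem card_dual (hG : IsDiagonalGroup G) : Nat.card (G →* kˣ) = Nat.card G := by
  let _ := hG.commGroup
  have := hasEnoughRootsOfUnity_exponent (G := G)
  exact CommGroup.card_monoidHom_of_hasEnoughRootsOfUnity G k

theorem finite_dual (hG : IsDiagonalGroup G) : Finite (G →* kˣ) :=
  Nat.finite_of_card_ne_zero (card_dual hG ▸ Nat.card_pos.ne')

theorem closure_range_weight (hG : IsDiagonalGroup G) :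
    Subgroup.closure (Set.range (weight hG)) = ⊤ := by
  let _ := hG.commGroup
  have := hasEnoughRootsOfUnity_exponent (G := G)
  exact closure_range_eq_top_of_faithful (eq_one_of_weight_eq_one hG)

end Dual

/-! ### The character lattice -/

theorem mem_invariantExponents_of_prod_zpow (hG : IsDiagonalGroup G) {u : Fin (n + 1) → ℤ}
    (hu : ∀ g, ∏ i, weight hG i g ^ u i = 1) (hnn : ∀ i, 0 ≤ u i) :
    u ∈ invariantExponents G := by
  refine ⟨Finsupp.equivFunOnFinite.symm fun i => (u i).toNat, fun g hg => ?_, fun i => by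
    simp [hnn i]⟩
  rw [polyAct_monomial hG hg, mul_one]
  congr 1
  have h1 := congrArg Units.val (hu ⟨g, hg⟩)
  simp only [Units.coe_prod, Units.val_zpow_eq_zpow_val, Units.val_one] at h1
  refine Eq.trans (Finset.prod_congr rfl fun i _ => ?_) h1
  rw [coe_weight]
  conv_rhs => rw [← Int.toNat_of_nonneg (hnn i), zpow_natCast]
  rfl

/-- `M` is the kernel of `ℤ^{n+1} → Ĝ`: a multiple of the all-ones vector makes any element of the
kernel nonnegative. -/
theorem mem_charLattice_iff (hG : IsDiagonalGroup G) {u : Fin (n + 1) → ℤ} :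
    u ∈ charLattice G ↔ ∀ g, ∏ i, weight hG i g ^ u i = 1 := by
  refine ⟨fun hu g => prod_zpow_eq_one hG g hu, fun hu => ?_⟩
  let c : ℤ := ∑ i, |u i|
  have h1 : (c • (fun _ => 1) : Fin (n + 1) → ℤ) ∈ charLattice G :=
    AddSubgroup.zsmul_mem _ (ones_mem_charLattice hG) c
  have h2 : u + c • (fun _ => 1) ∈ charLattice G := by
    refine AddSubgroup.subset_closure (mem_invariantExponents_of_prod_zpow hG (fun g => ?_) ?_)
    · have h3 := prod_zpow_eq_one hG g h1
      simp only [Pi.add_apply, zpow_add, Finset.prod_mul_distrib, hu g, one_mul]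
      exact h3
    · intro i
      have h3 : |u i| ≤ c := Finset.single_le_sum (f := fun i => |u i|)
        (fun j _ => abs_nonneg _) (Finset.mem_univ i)
      have h4 := neg_abs_le (u i)
      simp only [Pi.add_apply, Pi.smul_apply, smul_eq_mul, mul_one]
      omega
  simpa using AddSubgroup.sub_mem _ h2 h1

theorem single_card_mem_invariantExponents [Finite G] (hG : IsDiagonalGroup G)
    (i : Fin (n + 1)) : Pi.single i (Nat.card G : ℤ) ∈ invariantExponents G := by
  refine mem_invariantExponents_of_prod_zpow hG (fun g => ?_) fun j => ?_
  · rw [Finset.prod_eq_single i]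
    · rw [Pi.single_eq_same, zpow_natCast, apply_pow_card]
    · intro j _ hj
      rw [Pi.single_eq_of_ne hj, zpow_zero]
    · simp
  · by_cases h : j = i
    · subst h; simp
    · simp [h]

theorem single_card_mem_charLattice [Finite G] (hG : IsDiagonalGroup G) (i : Fin (n + 1)) :
    Pi.single i (Nat.card G : ℤ) ∈ charLattice G :=
  AddSubgroup.subset_closure (single_card_mem_invariantExponents hG i)

/-- `Λ = m · M^∨`: since `ρ_1 ⋯ ρ_{n+1} = 1`, the lattice `M` is the direct sum of `L_1` and the
multiples of the all-ones vector. -/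
theorem mem_typeLattice_iff (hG : IsDiagonalGroup G) {γ : Fin (n + 1) → ℝ} :
    γ ∈ typeLattice hG ↔
      ∀ u ∈ charLattice G, ∃ z : ℤ, ∑ i, (u i : ℝ) * γ i = (Nat.card G : ℝ) * z := by
  constructor
  · rintro ⟨h1, z, hz⟩ u hu
    have hy : (fun i : Fin n => u i.castSucc - u (Fin.last n)) ∈ kernelLattice hG := by
      intro g
      have h2 := prod_zpow_eq_one hG g hu
      have h3 : ∏ i, weight hG i g = 1 := by
        simpa using prod_zpow_eq_one hG g (ones_mem_charLattice hG)
      rw [Fin.prod_univ_castSucc] at h2 h3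
      simp only [zpow_sub, Finset.prod_mul_distrib, Finset.prod_inv_distrib, Finset.prod_zpow]
      rw [eq_inv_of_mul_eq_one_left h3, eq_inv_of_mul_eq_one_left h2, inv_zpow, inv_inv,
        inv_mul_cancel]
    obtain ⟨w, hw⟩ := h1 _ hy
    refine ⟨w + u (Fin.last n) * z, ?_⟩
    push_cast at hw ⊢
    have h4 : (Nat.card G : ℝ) * (w + u (Fin.last n) * z)
        = (Nat.card G : ℝ) * w + u (Fin.last n) * ((Nat.card G : ℝ) * z) := by ring
    rw [h4, ← hw, ← hz, Fin.sum_univ_castSucc, Fin.sum_univ_castSucc, mul_add, Finset.mul_sum,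
      ← add_assoc, ← Finset.sum_add_distrib]
    congr 1
    exact Finset.sum_congr rfl fun i _ => by ring
  · intro h
    refine ⟨fun y hy => ?_, ?_⟩
    · obtain ⟨z, hz⟩ := h (Fin.snoc y 0 : Fin (n + 1) → ℤ)
        ((mem_charLattice_iff hG).2 fun g => by simpa [Fin.prod_univ_castSucc] using hy g)
      refine ⟨z, hz ▸ ?_⟩
      simp [Fin.sum_univ_castSucc, mul_comm]
    · obtain ⟨z, hz⟩ := h _ (ones_mem_charLattice hG)
      exact ⟨z, by simpa using hz⟩

theorem single_card_mem_typeLattice (hG : IsDiagonalGroup G) (i : Fin (n + 1)) :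
    Pi.single i (Nat.card G : ℝ) ∈ typeLattice hG := by
  refine (mem_typeLattice_iff hG).2 fun u _ => ⟨u i, ?_⟩
  rw [Finset.sum_eq_single i] <;> simp +contextual [mul_comm]

section Finite

variable [Finite G]

theorem card_ne_zero_real : (Nat.card G : ℝ) ≠ 0 := Nat.cast_ne_zero.2 Nat.card_pos.ne'

theorem exists_int_of_mem_typeLattice (hG : IsDiagonalGroup G) {γ : Fin (n + 1) → ℝ}
    (hγ : γ ∈ typeLattice hG) (i : Fin (n + 1)) : ∃ z : ℤ, γ i = z := by
  obtain ⟨z, hz⟩ := (mem_typeLattice_iff hG).1 hγ _ (single_card_mem_charLattice hG i)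
  refine ⟨z, mul_left_cancel₀ card_ne_zero_real (Eq.trans ?_ hz)⟩
  rw [Finset.sum_eq_single i] <;> simp +contextual

theorem isLattice_typeLattice (hG : IsDiagonalGroup G) : IsLattice (typeLattice hG) :=
  isLattice_of_smul_single_mem card_ne_zero_real (single_card_mem_typeLattice hG)
    fun _ hγ => exists_int_of_mem_typeLattice hG hγ

/-- The dilation `γ ↦ γ / m`. -/
def dilation (G : Subgroup (Matrix.SpecialLinearGroup (Fin (n + 1)) k)) [Finite G] :
    (Fin (n + 1) → ℝ) ≃ₗ[ℝ] (Fin (n + 1) → ℝ) :=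
  LinearEquiv.smulOfNeZero ℝ _ (Nat.card G : ℝ)⁻¹ (inv_ne_zero card_ne_zero_real)

theorem dilation_apply (γ : Fin (n + 1) → ℝ) : dilation G γ = (Nat.card G : ℝ)⁻¹ • γ := rfl

end Finite

/-! ### The simplex of types -/

section Simplex

variable [IsAlgClosed k] [CharZero k] [Finite G]

theorem typeVector_trivialCut (hG : IsDiagonalGroup G) (i : Fin (n + 1)) :
    typeVector (trivialCut G i) = Pi.single i (Nat.card G : ℝ) := by
  ext j
  by_cases h : j = i
  · subst h
    have h1 : {a : Arrow G | a ∈ trivialCut G j ∧ a.ty = j} = Set.range fun χ => ⟨χ, j⟩ := by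
      ext ⟨χ, l⟩
      simp [trivialCut, eq_comm]
    rw [typeVector, h1, ← Set.image_univ, Set.ncard_image_of_injective, Set.ncard_univ,
      card_dual hG, Pi.single_eq_same]
    intro χ ψ hχ
    exact congrArg Arrow.src hχ
  · rw [Pi.single_eq_of_ne h, typeVector]
    have h1 : {a : Arrow G | a ∈ trivialCut G i ∧ a.ty = j} = ∅ := by
      ext ⟨χ, l⟩
      simp only [trivialCut, Set.mem_ofPred_eq, Set.mem_empty_iff_false, iff_false]
      rintro ⟨rfl, rfl⟩
      exact h rfl
    rw [h1]
    simp

theorem dilation_image_typeSimplex (hG : IsDiagonalGroup G) :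
    dilation G '' typeSimplex G = stdSimplex ℝ (Fin (n + 1)) := by
  have h := (dilation G).toLinearMap.image_convexHull
    (Set.range fun i => typeVector (trivialCut G i))
  refine h.trans ?_
  rw [← convexHull_rangle_single_eq_stdSimplex, ← Set.range_comp]
  congr 2
  ext1 i
  simp only [Function.comp_apply, typeVector_trivialCut hG]
  change (Nat.card G : ℝ)⁻¹ • Pi.single i (Nat.card G : ℝ) = _
  rw [← Pi.single_smul, smul_eq_mul, inv_mul_cancel₀ card_ne_zero_real]

theorem mem_typeSimplex_iff (hG : IsDiagonalGroup G) {γ : Fin (n + 1) → ℝ} :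
    γ ∈ typeSimplex G ↔ (∀ i, 0 ≤ γ i) ∧ ∑ i, γ i = Nat.card G := by
  rw [← (dilation G).injective.mem_set_image, dilation_image_typeSimplex hG, dilation_apply]
  have hm : (0 : ℝ) < Nat.card G := Nat.cast_pos.2 Nat.card_pos
  simp only [stdSimplex, Set.mem_ofPred_eq, Pi.smul_apply, smul_eq_mul, ← Finset.mul_sum]
  refine and_congr (forall_congr' fun i => ?_) ?_
  · exact mul_nonneg_iff_of_pos_left (inv_pos.2 hm)
  · rw [inv_mul_eq_one₀ hm.ne', eq_comm]

theorem isLatticeSimplex_typeSimplex (hG : IsDiagonalGroup G) :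
    IsLatticeSimplex n (typeLattice hG) (typeSimplex G) := by
  refine ⟨isLattice_typeLattice hG, fun i => typeVector (trivialCut G i), ?_, fun i => ?_, rfl⟩
  · have h1 : (fun i => typeVector (trivialCut G i))
        = (dilation G).symm ∘ fun i => (Pi.basisFun ℝ (Fin (n + 1)) i) := by
      funext i
      rw [Function.comp_apply, LinearEquiv.eq_symm_apply, typeVector_trivialCut hG,
        dilation_apply, ← Pi.single_smul, smul_eq_mul, inv_mul_cancel₀ card_ne_zero_real,
        Pi.basisFun_apply]
    rw [h1]
    exact (Pi.basisFun ℝ (Fin (n + 1))).linearIndependent.affineIndependent.map'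
      (dilation G).symm.toLinearMap.toAffineMap (dilation G).symm.injective
  · simp only [typeVector_trivialCut hG]
    exact single_card_mem_typeLattice hG i

end Simplex

/-! ### One-parameter subgroups and the defining cone -/

/-- `N` is the whole dual lattice `Hom(M, ℤ)`: a homomorphism `a : M → ℤ` comes from the
one-parameter subgroup `t ↦ (u ↦ t ^ a u)`. -/
theorem mem_oneParamLattice_iff [CharZero k] {v : charLattice G →+ ℝ} :
    v ∈ oneParamLattice G ↔ ∀ u, ∃ z : ℤ, v u = z := by
  constructor
  · rintro ⟨l, rfl⟩ u
    exact ⟨pairing u l.toMul, rfl⟩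
  · intro h
    choose a ha using h
    have ha_add : ∀ u w, a (u + w) = a u + a w := fun u w => by
      have h1 := map_add v u w
      rw [ha, ha, ha] at h1
      exact_mod_cast h1
    have ha_zero : a 0 = 0 := by simpa using ha_add 0 0
    let l : kˣ →* torus G :=
      { toFun := fun t =>
          { toFun := fun u => t ^ a u.toAdd
            map_one' := by simp [ha_zero]
            map_mul' := fun u w => by simp [ha_add, zpow_add] }
        map_one' := by ext; simp
        map_mul' := fun s t => by ext; simp [mul_zpow] }
    have hl : l ∈ oneParam G := fun u => ⟨LaurentPolynomial.T (a u), fun t => by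
      rw [LaurentPolynomial.eval₂_T]; rfl⟩
    refine ⟨Additive.ofMul ⟨l, hl⟩, AddMonoidHom.ext fun u => ?_⟩
    rw [ha]
    change ((pairing u ⟨l, hl⟩ : ℤ) : ℝ) = a u
    exact congrArg _ (eq_of_forall_zpow_eq (k := k) fun t => (pairing_spec u ⟨l, hl⟩ t).symm)

section Toric

variable [Finite G]

/-- `m e_i`, as an element of `M`. -/
def cardSingle (hG : IsDiagonalGroup G) (i : Fin (n + 1)) : charLattice G :=
  ⟨Pi.single i (Nat.card G : ℤ), single_card_mem_charLattice hG i⟩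

theorem card_nsmul_eq_sum (hG : IsDiagonalGroup G) (u : charLattice G) :
    Nat.card G • u = ∑ i, (u : Fin (n + 1) → ℤ) i • cardSingle hG i := by
  refine Subtype.ext (funext fun j => ?_)
  simp only [AddSubgroup.coe_nsmul, AddSubgroup.val_finsetSum, AddSubgroup.coe_zsmul, cardSingle,
    Pi.smul_apply, Finset.sum_apply, smul_eq_mul, nsmul_eq_mul]
  rw [Finset.sum_eq_single j] <;> simp +contextual [mul_comm, eq_comm]

/-- The isomorphism `Φ : ℝ^{n+1} → N_ℝ`, `⟨u, Φ(γ)⟩ = ⟨u, γ⟩ / m`. Its inverse evaluates a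
functional on `M` at the vectors `m e_i`. -/
def toricEquiv (hG : IsDiagonalGroup G) : (Fin (n + 1) → ℝ) ≃ₗ[ℝ] (charLattice G →+ ℝ) where
  toFun γ := AddMonoidHom.mk'
    (fun u => (∑ i, ((u : Fin (n + 1) → ℤ) i : ℝ) * γ i) / (Nat.card G : ℝ)) fun u w => by
      simp [add_mul, Finset.sum_add_distrib, add_div]
  map_add' γ δ := by
    ext u
    simp [mul_add, Finset.sum_add_distrib, add_div]
  map_smul' c γ := by
    ext u
    simp only [AddMonoidHom.mk'_apply, Pi.smul_apply, smul_eq_mul, RingHom.id_apply,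
      AddMonoidHom.smul_apply, mul_left_comm _ c, ← Finset.mul_sum, mul_div_assoc]
  invFun v i := v (cardSingle hG i)
  left_inv γ := by
    funext i
    change (∑ j, ((Pi.single i (Nat.card G : ℤ) : Fin (n + 1) → ℤ) j : ℝ) * γ j) /
      (Nat.card G : ℝ) = γ i
    rw [Finset.sum_eq_single i] <;> simp +contextual
    exact mul_div_cancel_left₀ _ card_ne_zero_real
  right_inv v := by
    ext u
    have h := congrArg v (card_nsmul_eq_sum hG u)
    rw [map_nsmul, map_sum] at h
    simp only [map_zsmul, nsmul_eq_mul, zsmul_eq_mul] at h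
    rw [AddMonoidHom.mk'_apply, ← h, mul_div_cancel_left₀ _ card_ne_zero_real]

theorem toricEquiv_apply (hG : IsDiagonalGroup G) (γ : Fin (n + 1) → ℝ) (u : charLattice G) :
    toricEquiv hG γ u
      = (∑ i, ((u : Fin (n + 1) → ℤ) i : ℝ) * γ i) / (Nat.card G : ℝ) := rfl

theorem toricEquiv_cardSingle (hG : IsDiagonalGroup G) (γ : Fin (n + 1) → ℝ)
    (i : Fin (n + 1)) : toricEquiv hG γ (cardSingle hG i) = γ i :=
  congrFun ((toricEquiv hG).symm_apply_apply γ) i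

theorem toricEquiv_mem_oneParamLattice_iff [CharZero k] (hG : IsDiagonalGroup G)
    {γ : Fin (n + 1) → ℝ} : toricEquiv hG γ ∈ oneParamLattice G ↔ γ ∈ typeLattice hG := by
  rw [mem_oneParamLattice_iff, mem_typeLattice_iff, Subtype.forall]
  refine forall₂_congr fun u hu => exists_congr fun z => ?_
  rw [toricEquiv_apply, div_eq_iff card_ne_zero_real, mul_comm (z : ℝ)]

theorem toricEquiv_mem_coneSlice_iff [IsAlgClosed k] [CharZero k] (hG : IsDiagonalGroup G)
    {γ : Fin (n + 1) → ℝ} : toricEquiv hG γ ∈ coneSlice hG ↔ γ ∈ typeSimplex G := by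
  rw [mem_typeSimplex_iff hG]
  refine and_congr ⟨fun h i => ?_, fun h u hu => ?_⟩ ?_
  · rw [← toricEquiv_cardSingle hG γ i]
    exact h _ (single_card_mem_invariantExponents hG i)
  · obtain ⟨e, -, he⟩ := hu
    rw [toricEquiv_apply]
    refine div_nonneg (Finset.sum_nonneg fun i _ => mul_nonneg ?_ (h i)) (Nat.cast_nonneg _)
    rw [he i]
    positivity
  · change toricEquiv hG γ ⟨fun _ => 1, ones_mem_charLattice hG⟩ = 1 ↔ _
    rw [toricEquiv_apply, div_eq_one_iff_eq card_ne_zero_real]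
    simp

theorem isLatticePolytopeIso_toricEquiv [IsAlgClosed k] [CharZero k] (hG : IsDiagonalGroup G) :
    IsLatticePolytopeIso (toricEquiv hG) (typeLattice hG) (typeSimplex G)
      (oneParamLattice G) (coneSlice hG) := by
  constructor <;> ext v <;> obtain ⟨γ, rfl⟩ := (toricEquiv hG).surjective v <;>
    rw [(toricEquiv hG).injective.mem_set_image]
  · exact (toricEquiv_mem_oneParamLattice_iff hG).symm
  · exact (toricEquiv_mem_coneSlice_iff hG).symm

end Toric

/-! ### Age vectors and junior elements -/

theorem prod_zpow_eq_zpow_sum {ι : Type*} {x : k} (hx : x ≠ 0) (s : Finset ι) (e : ι → ℤ) :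
    ∏ i ∈ s, x ^ e i = x ^ ∑ i ∈ s, e i := by
  classical
  induction s using Finset.induction_on with
  | empty => simp
  | insert i s hi ih => rw [Finset.prod_insert hi, Finset.sum_insert hi, zpow_add₀ hx, ih]

/-- The value of `v(g)` is read off from any exponent in the range `0 ≤ f < m`. -/
theorem ageVector_eq_of_pow_eq {ξ : k} (hξ : IsPrimitiveRoot ξ (Nat.card G)) {g : G} {i : Fin (n + 1)}
    {f : ℕ} (hf : f < Nat.card G) (h : ξ ^ f = g.1.1 i i) :
    ageVector ξ g i = f / (Nat.card G : ℝ) := by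
  have h1 : sInf {f : ℕ | ξ ^ f = g.1.1 i i} = f := by
    have hle : sInf {f : ℕ | ξ ^ f = g.1.1 i i} ≤ f := Nat.sInf_le h
    have hmem : sInf {f : ℕ | ξ ^ f = g.1.1 i i} ∈ {f : ℕ | ξ ^ f = g.1.1 i i} :=
      Nat.sInf_mem ⟨f, h⟩
    exact hξ.pow_inj (hle.trans_lt hf) hf (hmem.trans h.symm)
  rw [ageVector, h1]

section Junior

variable [Finite G] {ξ : k}

theorem exists_apply_eq_pow (hξ : IsPrimitiveRoot ξ (Nat.card G))
    (χ : G →* kˣ) (g : G) : ∃ f < Nat.card G, ξ ^ f = (χ g : k) :=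
  haveI : NeZero (Nat.card G) := ⟨Nat.card_pos.ne'⟩
  hξ.eq_pow_of_pow_eq_one (by rw [← Units.val_pow_eq_pow_val, apply_pow_card, Units.val_one])

theorem exists_ageVector_eq (hG : IsDiagonalGroup G) (hξ : IsPrimitiveRoot ξ (Nat.card G))
    (g : G) : ∃ f : Fin (n + 1) → ℕ, (∀ i, f i < Nat.card G) ∧
      (∀ i, ξ ^ f i = (weight hG i g : k)) ∧ ∀ i, ageVector ξ g i = f i / (Nat.card G : ℝ) := by
  choose f hf hfg using fun i => exists_apply_eq_pow hξ (weight hG i) g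
  exact ⟨f, hf, hfg, fun i => ageVector_eq_of_pow_eq hξ (hf i) (hfg i)⟩

theorem ageVector_injective (hG : IsDiagonalGroup G) (hξ : IsPrimitiveRoot ξ (Nat.card G)) :
    Function.Injective fun g : G => ageVector ξ g := by
  intro g h hgh
  obtain ⟨f, -, hf, hfg⟩ := exists_ageVector_eq hG hξ g
  obtain ⟨f', -, hf', hfh⟩ := exists_ageVector_eq hG hξ h
  refine hG.ext fun i => ?_
  have h1 : ageVector ξ g i = ageVector ξ h i := congrFun hgh i
  rw [hfg, hfh, div_left_inj' card_ne_zero_real, Nat.cast_inj] at h1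
  rw [← coe_weight hG, ← coe_weight hG, ← hf, ← hf', h1]

/-- The exponents `a_i` of the weights `ρ_i(g) = ξ^{a_i}` form a vector of `Λ`. -/
theorem mem_typeLattice_of_weight_eq_zpow (hG : IsDiagonalGroup G)
    (hξ : IsPrimitiveRoot ξ (Nat.card G)) {g : G} {a : Fin (n + 1) → ℤ}
    (ha : ∀ i, (weight hG i g : k) = ξ ^ a i) : (fun i => (a i : ℝ)) ∈ typeLattice hG := by
  refine (mem_typeLattice_iff hG).2 fun u hu => ?_
  have h1 := congrArg Units.val (prod_zpow_eq_one hG g hu)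
  simp only [Units.coe_prod, Units.val_zpow_eq_zpow_val, ha, Units.val_one, ← zpow_mul] at h1
  rw [prod_zpow_eq_zpow_sum (hξ.ne_zero Nat.card_pos.ne'), hξ.zpow_eq_one_iff_dvd] at h1
  obtain ⟨z, hz⟩ := h1
  refine ⟨z, ?_⟩
  have h2 : ∑ i, u i * a i = (Nat.card G : ℤ) * z := by simpa [mul_comm] using hz
  exact_mod_cast h2

variable [IsAlgClosed k] [CharZero k]

/-- Every vector `a` of `Λ` is a vector of exponents: the point `(ξ^{a_1}, …, ξ^{a_{n+1}})` is
killed by all characters in `M`, hence belongs to `G` by duality. -/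
theorem exists_weight_eq_zpow (hG : IsDiagonalGroup G) (hξ : IsPrimitiveRoot ξ (Nat.card G))
    {a : Fin (n + 1) → ℤ} (ha : (fun i => (a i : ℝ)) ∈ typeLattice hG) :
    ∃ g : G, ∀ i, (weight hG i g : k) = ξ ^ a i := by
  let _ := hG.commGroup
  have := hasEnoughRootsOfUnity_exponent (G := G)
  have hξ0 : ξ ≠ 0 := hξ.ne_zero Nat.card_pos.ne'
  obtain ⟨g, hg⟩ := exists_apply_eq_of_forall_prod_zpow (eq_one_of_weight_eq_one hG)
    (fun i => Units.mk0 ξ hξ0 ^ a i) fun u hu => by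
      obtain ⟨z, hz⟩ := (mem_typeLattice_iff hG).1 ha u ((mem_charLattice_iff hG).2 fun g => by
        simpa using DFunLike.congr_fun hu g)
      have h2 : ∑ i, u i * a i = (Nat.card G : ℤ) * z := by exact_mod_cast hz
      ext
      simp only [Units.coe_prod, Units.val_zpow_eq_zpow_val, Units.val_mk0, Units.val_one,
        ← zpow_mul]
      rw [prod_zpow_eq_zpow_sum hξ0, hξ.zpow_eq_one_iff_dvd]
      exact ⟨z, by simpa [mul_comm] using h2⟩
  exact ⟨g, fun i => by simp [hg i]⟩

theorem dilation_image_typeLattice (hG : IsDiagonalGroup G)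
    (hξ : IsPrimitiveRoot ξ (Nat.card G)) :
    dilation G '' (typeLattice hG : Set (Fin (n + 1) → ℝ)) = groupLattice G ξ := by
  have hm := card_ne_zero_real (G := G)
  apply subset_antisymm
  · rintro _ ⟨γ, hγ, rfl⟩
    choose a ha using exists_int_of_mem_typeLattice hG hγ
    obtain rfl : γ = fun i => (a i : ℝ) := funext ha
    obtain ⟨g, hg⟩ := exists_weight_eq_zpow hG hξ hγ
    obtain ⟨f, -, hf, hfg⟩ := exists_ageVector_eq hG hξ g
    have hdvd : ∀ i, (Nat.card G : ℤ) ∣ a i - f i := fun i => by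
      rw [← hξ.zpow_eq_one_iff_dvd, zpow_sub₀ (hξ.ne_zero Nat.card_pos.ne'), zpow_natCast, hf i,
        hg i]
      exact div_self (hg i ▸ (weight hG i g).ne_zero)
    choose z hz using hdvd
    have h1 : dilation G (fun i => (a i : ℝ)) = (fun i => (z i : ℝ)) + ageVector ξ g := by
      funext i
      have h2 : (a i : ℝ) = Nat.card G * z i + f i := by
        have := hz i
        rw [sub_eq_iff_eq_add] at this
        exact_mod_cast this
      rw [dilation_apply, Pi.smul_apply, Pi.add_apply, hfg, smul_eq_mul, h2]
      field_simp
    rw [h1]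
    exact AddSubgroup.add_mem _ (AddSubgroup.subset_closure (Or.inl ⟨z, fun _ => rfl⟩))
      (AddSubgroup.subset_closure (Or.inr ⟨g, rfl⟩))
  · have h1 : groupLattice G ξ ≤
        (typeLattice hG).map (dilation G).toLinearMap.toAddMonoidHom := by
      refine (AddSubgroup.closure_le _).2 ?_
      rintro _ (⟨z, hz⟩ | ⟨g, rfl⟩)
      · refine ⟨fun i => Nat.card G * z i, (mem_typeLattice_iff hG).2 fun u _ =>
          ⟨∑ i, u i * z i, ?_⟩, ?_⟩
        · push_cast
          rw [Finset.mul_sum]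
          exact Finset.sum_congr rfl fun i _ => by ring
        · funext i
          change (Nat.card G : ℝ)⁻¹ * (Nat.card G * z i) = _
          rw [inv_mul_cancel_left₀ hm, hz]
      · obtain ⟨f, -, hf, hfg⟩ := exists_ageVector_eq hG hξ g
        refine ⟨fun i => (f i : ℝ), ?_, ?_⟩
        · exact mem_typeLattice_of_weight_eq_zpow hG hξ (a := fun i => (f i : ℤ)) fun i => by
            rw [zpow_natCast, hf i]
        · funext i
          change (Nat.card G : ℝ)⁻¹ * f i = ageVector ξ g i
          rw [hfg, div_eq_inv_mul]
    exact fun v hv => h1 hv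

theorem isLatticePolytopeIso_dilation (hG : IsDiagonalGroup G)
    (hξ : IsPrimitiveRoot ξ (Nat.card G)) :
    IsLatticePolytopeIso (dilation G) (typeLattice hG) (typeSimplex G)
      (groupLattice G ξ) (stdSimplex ℝ (Fin (n + 1))) :=
  ⟨dilation_image_typeLattice hG hξ, dilation_image_typeSimplex hG⟩

/-- Age vectors have entries in `[0, 1)`, so those of junior elements lie in the junior simplex away
from its vertices. Conversely, a lattice point of the simplex other than a vertex is `a / m` with
`0 ≤ a_i < m`, and `g = diag(ξ^{a_i})` is the junior element it comes from. -/
theorem bijOn_ageVector (hG : IsDiagonalGroup G) (hξ : IsPrimitiveRoot ξ (Nat.card G)) :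
    Set.BijOn (fun g : G => ageVector ξ g) {g | IsJunior ξ g}
      ((stdSimplex ℝ (Fin (n + 1)) ∩ (groupLattice G ξ : Set (Fin (n + 1) → ℝ))) \
        Set.range fun i => Pi.single i 1) := by
  have hm : (0 : ℝ) < Nat.card G := Nat.cast_pos.2 Nat.card_pos
  refine ⟨fun g hg => ⟨⟨⟨fun i => ?_, hg⟩, AddSubgroup.subset_closure (Or.inr ⟨g, rfl⟩)⟩, ?_⟩,
    (ageVector_injective hG hξ).injOn, ?_⟩
  · exact div_nonneg (Nat.cast_nonneg _) (Nat.cast_nonneg _)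
  · rintro ⟨i, hi⟩
    obtain ⟨f, hf, -, hfg⟩ := exists_ageVector_eq hG hξ g
    have h1 : ageVector ξ g i = 1 := by
      exact (congrFun hi i).symm.trans (Pi.single_eq_same i 1)
    rw [hfg, div_eq_one_iff_eq hm.ne', Nat.cast_inj] at h1
    exact (hf i).ne h1
  · rintro w ⟨⟨hw, hwN⟩, hwv⟩
    rw [← dilation_image_typeLattice hG hξ] at hwN
    obtain ⟨γ, hγ, rfl⟩ := hwN
    choose a ha using exists_int_of_mem_typeLattice hG hγ
    obtain rfl : γ = fun i => (a i : ℝ) := funext ha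
    obtain ⟨g, hg⟩ := exists_weight_eq_zpow hG hξ hγ
    have hval : ∀ i, dilation G (fun i => (a i : ℝ)) i = a i / (Nat.card G : ℝ) := fun i =>
      (div_eq_inv_mul _ _).symm
    have hnn : ∀ i, 0 ≤ a i := fun i => by
      have h1 := hw.1 i
      rw [hval, le_div_iff₀ hm, zero_mul] at h1
      exact_mod_cast h1
    have hlt : ∀ i, a i < Nat.card G := fun i => by
      by_contra! hle
      refine hwv ⟨i, ?_⟩
      have h1 : 1 ≤ dilation G (fun i => (a i : ℝ)) i := by
        rw [hval, le_div_iff₀ hm, one_mul]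
        exact_mod_cast hle
      have h2 := hw.2
      rw [← Finset.add_sum_erase _ _ (Finset.mem_univ i)] at h2
      have h3 : 0 ≤ ∑ j ∈ Finset.univ.erase i, dilation G (fun i => (a i : ℝ)) j :=
        Finset.sum_nonneg fun j _ => hw.1 j
      have h4 := (Finset.sum_eq_zero_iff_of_nonneg fun j _ => hw.1 j).1
        (show ∑ j ∈ Finset.univ.erase i, dilation G (fun i => (a i : ℝ)) j = 0 by linarith)
      funext j
      by_cases hj : j = i
      · subst hj
        simp only [Pi.single_eq_same]
        linarith
      · simp only [Pi.single_eq_of_ne hj]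
        exact (h4 j (Finset.mem_erase.2 ⟨hj, Finset.mem_univ j⟩)).symm
    have hage : ageVector ξ g = dilation G (fun i => (a i : ℝ)) := by
      funext i
      rw [hval, ageVector_eq_of_pow_eq hξ (f := (a i).toNat) (by have := hlt i; have := hnn i; omega)]
      · rw [← Int.cast_natCast, Int.toNat_of_nonneg (hnn i)]
      · rw [← zpow_natCast, Int.toNat_of_nonneg (hnn i), ← hg i, coe_weight]
    refine ⟨g, ?_, hage⟩
    change ∑ i, ageVector ξ g i = 1
    rw [hage]
    exact hw.2

end Junior

/-! ### Weights of paths -/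

@[to_additive]
theorem prod_map_eq_prod_pow_count {ι B : Type*} [Fintype ι] [DecidableEq ι] [CommMonoid B]
    (l : List ι) (f : ι → B) : (l.map f).prod = ∏ i, f i ^ l.count i := by
  rw [Finset.prod_list_map_count]
  refine Finset.prod_subset (Finset.subset_univ _) fun i _ hi => ?_
  rw [List.count_eq_zero.2 (by simpa using hi), pow_zero]

section PathWeight

variable {A ι : Type*} [CommGroup A] {ρ : ι → A} {w : A → ι → ℤ}

/-- The weight of the path that starts at `χ` and whose arrows have the types in the list, where
`w χ i` is the weight of the arrow of type `i` from `χ` to `χ * ρ i`. -/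
def pathWeight (ρ : ι → A) (w : A → ι → ℤ) : A → List ι → ℤ
  | _, [] => 0
  | χ, i :: l => w χ i + pathWeight ρ w (χ * ρ i) l

theorem pathWeight_eq_sum (χ : A) (l : List ι) :
    pathWeight ρ w χ l
      = ∑ j : Fin l.length, w (χ * ((l.take j).map ρ).prod) (l.get j) := by
  induction l generalizing χ with
  | nil => rfl
  | cons i l ih =>
    rw [pathWeight, ih]
    refine Eq.trans ?_ (Fin.sum_univ_succ (n := l.length)
      (fun j => w (χ * (((i :: l).take j).map ρ).prod) ((i :: l).get j))).symm
    simp [mul_assoc]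

theorem mul_prod_map_take_succ (ρ : ι → A) (χ : A) {l : List ι} {j : ℕ} (hj : j < l.length) :
    χ * ((l.take j).map ρ).prod * ρ l[j] = χ * ((l.take (j + 1)).map ρ).prod := by
  rw [List.take_succ_eq_append_getElem hj, List.map_append, List.prod_append, mul_assoc]
  simp

theorem pathWeight_concat (χ : A) (l : List ι) (i : ι) :
    pathWeight ρ w χ (l ++ [i]) = pathWeight ρ w χ l + w (χ * (l.map ρ).prod) i := by
  induction l generalizing χ with
  | nil => simp [pathWeight]
  | cons j l ih => simp [pathWeight, ih, mul_assoc, add_assoc]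

/-- Under the cocycle condition on `w`, the types of the arrows of a path may be permuted. -/
theorem pathWeight_perm
    (hw : ∀ χ i j, w χ i + w (χ * ρ i) j = w χ j + w (χ * ρ j) i) {l l' : List ι}
    (h : l.Perm l') (χ : A) : pathWeight ρ w χ l = pathWeight ρ w χ l' := by
  induction h generalizing χ with
  | nil => rfl
  | cons i _ ih => simp [pathWeight, ih]
  | swap i j l =>
    simp only [pathWeight, ← add_assoc, hw χ i j, mul_right_comm χ (ρ i)]
  | trans _ _ ih₁ ih₂ => rw [ih₁, ih₂]

/-- The weight of a closed path does not change when the path is moved along an arrow of type `i`: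
moving that arrow from the beginning of the path to its end is a permutation of the types. Since the
quiver is connected, the starting point does not matter. -/
theorem pathWeight_eq_of_closed (hρ : Subgroup.closure (Set.range ρ) = ⊤)
    (hw : ∀ χ i j, w χ i + w (χ * ρ i) j = w χ j + w (χ * ρ j) i) {l : List ι}
    (hl : (l.map ρ).prod = 1) (χ : A) : pathWeight ρ w χ l = pathWeight ρ w 1 l := by
  have hstep : ∀ χ i, pathWeight ρ w (χ * ρ i) l = pathWeight ρ w χ l := by
    intro χ i
    have h1 := pathWeight_perm hw (List.perm_append_singleton i l).symm χ
    rw [pathWeight, pathWeight_concat, hl, mul_one] at h1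
    linarith
  have hχ : χ ∈ Subgroup.closure (Set.range ρ) := hρ ▸ Subgroup.mem_top χ
  have key : ∀ ψ, pathWeight ρ w (ψ * χ) l = pathWeight ρ w ψ l := by
    induction hχ using Subgroup.closure_induction with
    | mem _ hx =>
      obtain ⟨i, rfl⟩ := hx
      exact fun ψ => hstep ψ i
    | one => simp
    | mul x y _ _ hx hy => exact fun ψ => by rw [← mul_assoc, hy, hx]
    | inv x _ hx => exact fun ψ => by rw [← hx, inv_mul_cancel_right]
  simpa using key 1

theorem sum_pathWeight [Fintype A] (l : List ι) :
    ∑ χ, pathWeight ρ w χ l = (l.map fun i => ∑ χ, w χ i).sum := by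
  induction l with
  | nil => simp [pathWeight]
  | cons i l ih =>
    simp only [pathWeight, Finset.sum_add_distrib, List.map_cons, List.sum_cons, ← ih]
    congr 1
    exact Equiv.sum_comp (Equiv.mulRight (ρ i)) fun χ => pathWeight ρ w χ l

/-- If `w` has weight `1` on all closed paths with one arrow of each type, then it is a cocycle:
replacing `i, j` by `j, i` at the beginning of such a path does not change its weight. -/
theorem weight_comm_of_pathWeight_eq_one [Fintype ι]
    (h : ∀ χ (l : List ι), l.Nodup → (∀ i, i ∈ l) → pathWeight ρ w χ l = 1) (χ : A) (i j : ι) :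
    w χ i + w (χ * ρ i) j = w χ j + w (χ * ρ j) i := by
  classical
  by_cases hij : i = j
  · rw [hij]
  · let l := ((Finset.univ.erase i).erase j).toList
    have hl : l.Nodup := Finset.nodup_toList _
    have hmem : ∀ x, x ∈ l ↔ x ≠ j ∧ x ≠ i := fun x => by simp [l]
    have h1 := h χ (i :: j :: l) (by simp [hmem, hl, hij])
      (fun x => by simp only [List.mem_cons, hmem]; tauto)
    have h2 := h χ (j :: i :: l) (by simp [hmem, hl, Ne.symm hij])
      (fun x => by simp only [List.mem_cons, hmem]; tauto)
    simp only [pathWeight, mul_right_comm χ (ρ j)] at h1 h2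
    linarith

end PathWeight

/-! ### Cuts -/

/-- The indicator function of a set of arrows. -/
def cutWeight (C : Set (Arrow G)) (χ : G →* kˣ) (i : Fin (n + 1)) : ℤ :=
  C.indicator 1 ⟨χ, i⟩

theorem typeVector_eq_sum [Fintype (G →* kˣ)] (C : Set (Arrow G)) (i : Fin (n + 1)) :
    typeVector C i = ((∑ χ, cutWeight C χ i : ℤ) : ℝ) := by
  classical
  have h1 : {a : Arrow G | a ∈ C ∧ a.ty = i}
      = (fun χ => ⟨χ, i⟩) '' {χ : G →* kˣ | (⟨χ, i⟩ : Arrow G) ∈ C} := by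
    ext ⟨χ, j⟩
    simp only [Set.mem_ofPred_eq, Set.mem_image, Arrow.mk.injEq]
    constructor
    · rintro ⟨h, rfl⟩
      exact ⟨χ, h, rfl, rfl⟩
    · rintro ⟨_, h, rfl, rfl⟩
      exact ⟨h, rfl⟩
  rw [typeVector, h1, Set.ncard_image_of_injective _ fun χ ψ h => congrArg Arrow.src h,
    Set.ncard_eq_toFinset_card']
  simp [cutWeight, Set.indicator_apply, Finset.sum_boole]

theorem existsUnique_mem_iff_sum_indicator {ι α : Type*} [Fintype ι] (C : Set α) (c : ι → α) :
    (∃! j, c j ∈ C) ↔ ∑ j, C.indicator (1 : α → ℤ) (c j) = 1 := by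
  classical
  simp only [Set.indicator_apply, Pi.one_apply, Finset.sum_boole]
  rw [Nat.cast_eq_one, Finset.card_eq_one]
  refine exists_congr fun j => ?_
  simp only [Finset.ext_iff, Finset.mem_filter, Finset.mem_univ, true_and, Finset.mem_singleton]
  exact ⟨fun h i => ⟨h.2 i, fun hi => hi ▸ h.1⟩, fun h => ⟨(h j).2 rfl, fun i => (h i).1⟩⟩

theorem isCut_iff_sum (hG : IsDiagonalGroup G) {C : Set (Arrow G)} :
    IsCut hG C ↔ ∀ c, IsElementaryCycle hG c → ∑ j, cutWeight C (c j).src (c j).ty = 1 :=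
  forall₂_congr fun c _ => existsUnique_mem_iff_sum_indicator C c

/-- A path with exactly one arrow of each type is closed because `ρ_1 ⋯ ρ_{n+1} = 1`, so it is an
elementary cycle and has weight `1` with respect to a cut. -/
theorem IsCut.pathWeight_eq_one {hG : IsDiagonalGroup G} {C : Set (Arrow G)} (hC : IsCut hG C)
    (χ : G →* kˣ) (l : List (Fin (n + 1))) (hl : l.Nodup) (hmem : ∀ i, i ∈ l) :
    pathWeight (weight hG) (cutWeight C) χ l = 1 := by
  have huniv : l.toFinset = Finset.univ := by
    ext i
    simp [hmem i]
  have hlen : l.length = n + 1 := by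
    rw [← List.toFinset_card_of_nodup hl, huniv, Finset.card_fin]
  have hprod : (l.map (weight hG)).prod = 1 := by
    rw [← prod_weight hG, ← huniv, List.prod_toFinset _ hl]
  rw [pathWeight_eq_sum]
  have h2 := (isCut_iff_sum hG).1 hC (fun j => ⟨χ * ((l.take j).map (weight hG)).prod,
    l.get (j.cast hlen.symm)⟩) ⟨fun j => ?_, fun i j hij => ?_⟩
  · rw [← h2]
    exact (Equiv.sum_comp (finCongr hlen.symm) _).symm
  · have hj : (j : ℕ) < l.length := hlen.symm ▸ j.2
    have h3 := mul_prod_map_take_succ (weight hG) χ hj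
    refine h3.trans ?_
    change _ = χ * ((l.take ((j + 1 : Fin (n + 1)) : ℕ)).map (weight hG)).prod
    by_cases hlast : j = Fin.last n
    · subst hlast
      rw [Fin.last_add_one, Fin.val_last, List.take_of_length_le hlen.le, hprod]
      simp
    · rw [Fin.val_add_one_of_lt (Fin.lt_last_iff_ne_last.2 hlast)]
  · exact Fin.cast_injective _ ((List.nodup_iff_injective_get.1 hl) hij)

section Finite

variable [IsAlgClosed k] [CharZero k] [Finite G]

/-- The type of a cut lies in `P ∩ Λ`. The sum over all vertices of the weights of the elementary
cycles of a fixed order of types is both `m` and `∑ γ_i`. For an invariant monomial `𝐱^u`, a path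
with `u_i` arrows of type `i` is closed and its weight `z` does not depend on the starting point, so
summing over all vertices gives `∑ u_i γ_i = m z`. -/
theorem IsCut.typeVector_mem {hG : IsDiagonalGroup G} {C : Set (Arrow G)} (hC : IsCut hG C) :
    typeVector C ∈ typeSimplex G ∩ (typeLattice hG : Set (Fin (n + 1) → ℝ)) := by
  have := finite_dual hG
  have := Fintype.ofFinite (G →* kˣ)
  have hcard : Fintype.card (G →* kˣ) = Nat.card G := by
    rw [← Nat.card_eq_fintype_card, card_dual hG]
  have hcomm := weight_comm_of_pathWeight_eq_one hC.pathWeight_eq_one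
  refine ⟨(mem_typeSimplex_iff hG).2 ⟨fun i => Nat.cast_nonneg _, ?_⟩,
    (mem_typeLattice_iff hG).2 fun u hu => ?_⟩
  · have h1 := sum_pathWeight (ρ := weight hG) (w := cutWeight C) (List.finRange (n + 1))
    simp only [hC.pathWeight_eq_one _ _ (List.nodup_finRange _) List.mem_finRange] at h1
    rw [← List.ofFn_eq_map, List.sum_ofFn] at h1
    simp only [typeVector_eq_sum]
    simp only [Finset.sum_const, Finset.card_univ, hcard] at h1
    rw [← Int.cast_sum, ← h1]
    simp
  · induction hu using AddSubgroup.closure_induction with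
    | mem u hu =>
      obtain ⟨e, hinv, he⟩ := hu
      let l : List (Fin (n + 1)) := (Finsupp.toMultiset e).toList
      have hcount : ∀ i, l.count i = e i := fun i => by
        rw [← Multiset.coe_count, Multiset.coe_toList, Finsupp.count_toMultiset]
      have hprod : (l.map (weight hG)).prod = 1 := by
        refine (prod_map_eq_prod_pow_count l (weight hG)).trans ?_
        ext g
        have h1 := prod_zpow_eq_one hG g (AddSubgroup.subset_closure ⟨e, hinv, he⟩)
        simp only [he, zpow_natCast] at h1
        simp [hcount, h1]
      have hsum : (l.map fun i => ∑ χ, cutWeight C χ i).sum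
          = ∑ i, (e i : ℤ) * ∑ χ, cutWeight C χ i := by
        simp [sum_map_eq_sum_nsmul_count, hcount]
      refine ⟨pathWeight (weight hG) (cutWeight C) 1 l, ?_⟩
      have h1 := sum_pathWeight (ρ := weight hG) (w := cutWeight C) l
      rw [Finset.sum_congr rfl fun χ _ => pathWeight_eq_of_closed
        (closure_range_weight hG) hcomm hprod χ, hsum, Finset.sum_const, Finset.card_univ, hcard,
        nsmul_eq_mul] at h1
      simp only [typeVector_eq_sum, he]
      exact_mod_cast h1.symm
    | zero => exact ⟨0, by simp⟩
    | add a b _ _ ha hb =>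
      obtain ⟨x, hx⟩ := ha
      obtain ⟨y, hy⟩ := hb
      refine ⟨x + y, ?_⟩
      simp only [Pi.add_apply, Int.cast_add, add_mul, Finset.sum_add_distrib, hx, hy, mul_add]
    | neg a _ ha =>
      obtain ⟨x, hx⟩ := ha
      refine ⟨-x, ?_⟩
      simp only [Pi.neg_apply, Int.cast_neg, neg_mul, Finset.sum_neg_distrib, hx, mul_neg]

/-- A lattice point `γ` of `P` is the type of a cut. Let `g ∈ G` have weights `ρ_i(g) = ξ^{γ_i}`
and write `χ(g) = ξ^{h(χ)}` with `0 ≤ h(χ) < m`. The cut consists of the arrows `χ → χ ρ_i` along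
which `h + γ_i` wraps around modulo `m`, i.e. `h(χ ρ_i) = h(χ) + γ_i - m`; both the cut condition
and the computation of the type are telescoping sums. -/
theorem mem_cutTypes_of_mem (hG : IsDiagonalGroup G) {γ : Fin (n + 1) → ℝ}
    (hP : γ ∈ typeSimplex G) (hγ : γ ∈ typeLattice hG) : γ ∈ cutTypes hG := by
  classical
  have := finite_dual hG
  have := Fintype.ofFinite (G →* kˣ)
  have hcard : Fintype.card (G →* kˣ) = Nat.card G := by
    rw [← Nat.card_eq_fintype_card, card_dual hG]
  have : NeZero ((Nat.card G : ℕ) : k) := ⟨Nat.cast_ne_zero.2 Nat.card_pos.ne'⟩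
  obtain ⟨ξ, hξ⟩ := HasEnoughRootsOfUnity.exists_primitiveRoot k (Nat.card G)
  have hξ0 : ξ ≠ 0 := hξ.ne_zero Nat.card_pos.ne'
  have hm : (0 : ℤ) < Nat.card G := Nat.cast_pos.2 Nat.card_pos
  choose a ha using exists_int_of_mem_typeLattice hG hγ
  obtain rfl : γ = fun i => (a i : ℝ) := funext ha
  obtain ⟨g, hg⟩ := exists_weight_eq_zpow hG hξ hγ
  obtain ⟨hnn, hsum⟩ := (mem_typeSimplex_iff hG).1 hP
  have hnn' : ∀ i, 0 ≤ a i := fun i => Int.cast_nonneg_iff.1 (hnn i)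
  have hsum' : ∑ i, a i = Nat.card G := by exact_mod_cast hsum
  have hle : ∀ i, a i ≤ Nat.card G := fun i =>
    hsum' ▸ Finset.single_le_sum (fun j _ => hnn' j) (Finset.mem_univ i)
  choose h hlt hh using fun χ : G →* kˣ => exists_apply_eq_pow hξ χ g
  let C : Set (Arrow G) := {b | (Nat.card G : ℤ) ≤ h b.src + a b.ty}
  -- the right-hand side is `m * z` and lies strictly between `-m` and `2 * m`, so `z` is `0` or `1`
  have hwrap : ∀ χ i, (Nat.card G : ℤ) * cutWeight C χ i
      = h χ + a i - h (χ * weight hG i) := by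
    intro χ i
    have hdvd : (Nat.card G : ℤ) ∣ h χ + a i - h (χ * weight hG i) := by
      rw [← hξ.zpow_eq_one_iff_dvd, zpow_sub₀ hξ0, zpow_add₀ hξ0, zpow_natCast, zpow_natCast,
        hh, hh, ← hg i, MonoidHom.mul_apply, Units.val_mul]
      exact div_self (mul_ne_zero (Units.ne_zero _) (Units.ne_zero _))
    obtain ⟨z, hz⟩ := hdvd
    have h1 := hlt χ
    have h2 := hlt (χ * weight hG i)
    have h3 := hnn' i
    have h4 := hle i
    rw [hz]
    congr 1
    by_cases hc : (Nat.card G : ℤ) ≤ h χ + a i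
    · have h5 : cutWeight C χ i = 1 := Set.indicator_of_mem (s := C) hc 1
      rw [h5]
      have h6 : 0 < z := by
        by_contra! hz0
        nlinarith
      have h7 : z < 2 := by
        by_contra! hz0
        nlinarith
      omega
    · have h5 : cutWeight C χ i = 0 := Set.indicator_of_notMem (s := C) hc 1
      rw [h5]
      have h6 : -1 < z := by
        by_contra! hz0
        nlinarith
      have h7 : z < 1 := by
        by_contra! hz0
        nlinarith
      omega
  refine ⟨C, (isCut_iff_sum hG).2 fun c hc => ?_, funext fun i => ?_⟩
  · refine mul_left_cancel₀ hm.ne' ?_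
    have h1 : ∀ j, (c j).src * weight hG (c j).ty = (c (j + 1)).src := hc.1
    have h2 : ∑ j, (h (c (j + 1)).src : ℤ) = ∑ j, (h (c j).src : ℤ) :=
      Equiv.sum_comp (Equiv.addRight 1) fun j => (h (c j).src : ℤ)
    have h3 : ∑ j, a (c j).ty = ∑ i, a i :=
      (Finite.injective_iff_bijective.1 hc.2).sum_comp a
    simp only [Finset.mul_sum, hwrap, h1, Finset.sum_sub_distrib, Finset.sum_add_distrib, h2, h3,
      hsum']
    ring
  · rw [typeVector_eq_sum, Int.cast_inj]
    refine mul_left_cancel₀ hm.ne' ?_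
    have h1 : ∑ χ, (h (χ * weight hG i) : ℤ) = ∑ χ, (h χ : ℤ) :=
      Equiv.sum_comp (Equiv.mulRight (weight hG i)) fun χ => (h χ : ℤ)
    simp only [Finset.mul_sum, hwrap, Finset.sum_sub_distrib, Finset.sum_add_distrib, h1,
      Finset.sum_const, Finset.card_univ, hcard]
    simp

theorem cutTypes_eq (hG : IsDiagonalGroup G) :
    cutTypes hG = typeSimplex G ∩ (typeLattice hG : Set (Fin (n + 1) → ℝ)) := by
  ext γ
  refine ⟨?_, fun h => mem_cutTypes_of_mem hG h.1 h.2⟩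
  rintro ⟨C, hC, rfl⟩
  exact hC.typeVector_mem

end Finite

end CutTypes

end

open CutTypes in
theorem mainTheorem12 {k : Type*} [Field k] [IsAlgClosed k] [CharZero k] (n : ℕ)
    (G : Subgroup (Matrix.SpecialLinearGroup (Fin (n + 1)) k)) [Finite G]
    (hG : IsDiagonalGroup G) :
    -- the types of cuts are the lattice points of the lattice simplex `P`
    IsLatticeSimplex n (typeLattice hG) (typeSimplex G) ∧
    cutTypes hG = typeSimplex G ∩ (typeLattice hG : Set (Fin (n + 1) → ℝ)) ∧
    -- the slice of the defining cone is a lattice simplex in `N`, isomorphic to `P`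
    IsLatticeSimplex n (oneParamLattice G) (coneSlice hG) ∧
    (∃ Φ : (Fin (n + 1) → ℝ) ≃ₗ[ℝ] (charLattice G →+ ℝ),
      (∀ γ u, Φ γ u = (∑ i, ((u : Fin (n + 1) → ℤ) i : ℝ) * γ i) / (Nat.card G : ℝ)) ∧
      IsLatticePolytopeIso Φ (typeLattice hG) (typeSimplex G)
        (oneParamLattice G) (coneSlice hG)) ∧
    -- the simplex of junior elements
    ∀ ξ : k, IsPrimitiveRoot ξ (Nat.card G) →
      IsLatticeSimplex n (groupLattice G ξ) (stdSimplex ℝ (Fin (n + 1))) ∧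
      (∃ Ψ : (Fin (n + 1) → ℝ) ≃ₗ[ℝ] (Fin (n + 1) → ℝ),
        (∀ γ, Ψ γ = (Nat.card G : ℝ)⁻¹ • γ) ∧
        IsLatticePolytopeIso Ψ (typeLattice hG) (typeSimplex G)
          (groupLattice G ξ) (stdSimplex ℝ (Fin (n + 1)))) ∧
      Set.BijOn (fun g : G => ageVector ξ g) {g | IsJunior ξ g}
        ((stdSimplex ℝ (Fin (n + 1)) ∩ (groupLattice G ξ : Set (Fin (n + 1) → ℝ))) \
          Set.range fun i => Pi.single i 1) := by
  have hP := isLatticeSimplex_typeSimplex hG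
  exact ⟨hP, cutTypes_eq hG, hP.of_iso _ (isLatticePolytopeIso_toricEquiv hG),
    ⟨toricEquiv hG, toricEquiv_apply hG, isLatticePolytopeIso_toricEquiv hG⟩,
    fun ξ hξ => ⟨hP.of_iso _ (isLatticePolytopeIso_dilation hG hξ),
      ⟨dilation G, dilation_apply, isLatticePolytopeIso_dilation hG hξ⟩, bijOn_ageVector hG hξ⟩⟩
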